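/- Let $h_1,\dots,h_{K_I}\in\mathbb C^{1\times M}$ and $g_1,\dots,g_{K_E}\in\mathbb C^{1\times M}$ be row vectors, let $\sigma_i>0$ and $\gamma_i>0$ $(1\le i\le K_I)$, $\alpha_j\ge 0$ $(1\le j\le K_E)$, $0<\zeta\le 1$ and $\beta\ge 0$, and put $G=\zeta\sum_{j}\alpha_j g_j^Hg_j$. Let $g(\beta)\in[-\infty,+\infty]$ be the infimum of $\sum_{i} w_i^H(\beta I-G)w_i$ over all $w_1,\dots,w_{K_I}\in\mathbb C^{M}$ with $$\frac{|h_iw_i|^2}{\sum_{k\ne i}|h_iw_k|^2+\sigma_i^2}\ \ge\ \gamma_i\qquad\text{for all } i .$$ For $\lambda\in\mathbb R^{K_I}$ write $A_i(\lambda)=\sum_{k\neq i}\lambda_k h_k^Hh_k+\beta I-G$ and $$m_i(\lambda)=\min_{\|w\|=1,\ h_iw\ne 0}\ \gamma_i\,\frac{w^HA_i(\lambda)w}{w^Hh_i^Hh_iw}.$$ Let $\lambda^{(0)}$ be any feasible power vector of the dual uplink problem, that is, $\lambda^{(0)}_i\ge 0$ for all $i$ and there are $\tilde w_1,\dots,\tilde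 w_{K_I}\in\mathbb C^M$ with $$\frac{\lambda^{(0)}_i\,\tilde w_i^Hh_i^Hh_i\tilde w_i}{\tilde w_i^HA_i(\lambda^{(0)})\tilde w_i}\ \ge\ \gamma_i\qquad\text{for all } i$$ (all denominators being nonzero), and let $\lambda^{(n+1)}_i=m_i(\lambda^{(n)})$ be the fixed-point iteration started at $\lambda^{(0)}$. **Proposition.** Suppose that $\beta I-G$ is not positive semidefinite and $g(\beta)=-\infty$. Then after finitely many steps the iteration reaches a point $\lambda^{(n)}$, $n\ge 0$, such that $$\sum_{k\ne i}\lambda_k^{(n)}h_k^Hh_k+\beta I-G\ \text{ is not positive semidefinite for some } i .$$ For the first such $n$, the iterates up to $\lambda^{(n)}$ are well defined: for every $m<n$ and every $i$ the minimum defining $m_i(\lambda^{(m)})$ exists and is attained. -/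

import Mathlib

open scoped ComplexOrder

noncomputable section

/-- The matrix `h^H h` of a channel row vector `h ∈ ℂ^{1×M}`; its `(a, b)` entry is
`conj (h a) * h b`. -/
def channelGram {M : ℕ} (h : Fin M → ℂ) : Matrix (Fin M) (Fin M) ℂ :=
  Matrix.vecMulVec (star h) h

/-- The Hermitian form `w^H A w` (its real part, which is all of it for Hermitian `A`). -/
def hermForm {M : ℕ} (A : Matrix (Fin M) (Fin M) ℂ) (w : Fin M → ℂ) : ℝ :=
  (star w ⬝ᵥ A.mulVec w).re

/-- The energy matrix `G = ζ ∑_j α_j g_j^H g_j` of the energy receivers. -/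
def energyMatrix {M KE : ℕ} (ζ : ℝ) (α : Fin KE → ℝ) (g : Fin KE → Fin M → ℂ) :
    Matrix (Fin M) (Fin M) ℂ :=
  (ζ : ℂ) • ∑ j, (α j : ℂ) • channelGram (g j)

/-- The (possibly indefinite) matrix `β I - G`. -/
def noiseMatrix {M : ℕ} (β : ℝ) (G : Matrix (Fin M) (Fin M) ℂ) : Matrix (Fin M) (Fin M) ℂ :=
  (β : ℂ) • (1 : Matrix (Fin M) (Fin M) ℂ) - G

/-- The downlink SINR of information receiver `i` under the beamforming vectors `w`. -/
def downlinkSINR {M KI : ℕ} (h : Fin KI → Fin M → ℂ) (σ : Fin KI → ℝ)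
    (w : Fin KI → Fin M → ℂ) (i : Fin KI) : ℝ :=
  ‖h i ⬝ᵥ w i‖ ^ 2 / (∑ k ∈ Finset.univ.erase i, ‖h i ⬝ᵥ w k‖ ^ 2 + σ i ^ 2)

/-- `g(β)`: the infimum of `∑_i w_i^H (β I - G) w_i` over all beamforming vectors that meet the
downlink SINR targets, as an extended real (`⊥ = -∞` when the problem is unbounded from below,
`⊤ = +∞` when it is infeasible). -/
def downlinkValue {M KI : ℕ} (h : Fin KI → Fin M → ℂ) (σ γ : Fin KI → ℝ)
    (G : Matrix (Fin M) (Fin M) ℂ) (β : ℝ) : EReal :=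
  ⨅ w ∈ {w : Fin KI → Fin M → ℂ | ∀ i, γ i ≤ downlinkSINR h σ w i},
    ((∑ i, hermForm (noiseMatrix β G) (w i) : ℝ) : EReal)

/-- `∑_{k ≠ i} lam_k h_k^H h_k + β I - G`, the interference-plus-noise matrix seen by user `i` in
the dual uplink. -/
def uplinkMatrix {M KI : ℕ} (h : Fin KI → Fin M → ℂ) (G : Matrix (Fin M) (Fin M) ℂ) (β : ℝ)
    (lam : Fin KI → ℝ) (i : Fin KI) : Matrix (Fin M) (Fin M) ℂ :=
  ∑ k ∈ Finset.univ.erase i, (lam k : ℂ) • channelGram (h k) + noiseMatrix β G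

/-- The uplink SINR of user `i` with receive vector `w` and powers `lam`. -/
def uplinkSINR {M KI : ℕ} (h : Fin KI → Fin M → ℂ) (G : Matrix (Fin M) (Fin M) ℂ) (β : ℝ)
    (lam : Fin KI → ℝ) (i : Fin KI) (w : Fin M → ℂ) : ℝ :=
  lam i * hermForm (channelGram (h i)) w / hermForm (uplinkMatrix h G β lam i) w

/-- `lam` is a feasible power vector of the dual uplink problem: it is nonnegative and, with some
receive vectors, meets all SINR targets. For positive targets a receive vector at which the
denominator of the SINR is not positive never meets its target. -/
def UplinkFeasible {M KI : ℕ} (h : Fin KI → Fin M → ℂ) (γ : Fin KI → ℝ)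
    (G : Matrix (Fin M) (Fin M) ℂ) (β : ℝ) (lam : Fin KI → ℝ) : Prop :=
  (∀ i, 0 ≤ lam i) ∧ ∃ w : Fin KI → Fin M → ℂ, ∀ i, γ i ≤ uplinkSINR h G β lam i (w i)

/-- The values `γ_i (w^H (∑_{k ≠ i} lam_k h_k^H h_k + β I - G) w) / (w^H h_i^H h_i w)` over the
Euclidean unit vectors `w` at which the quotient is defined, i.e. `h_i w ≠ 0`. -/
def updateValues {M KI : ℕ} (h : Fin KI → Fin M → ℂ) (γ : Fin KI → ℝ)
    (G : Matrix (Fin M) (Fin M) ℂ) (β : ℝ) (lam : Fin KI → ℝ) (i : Fin KI) : Set ℝ :=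
  {r | ∃ w : Fin M → ℂ, ∑ a, ‖w a‖ ^ 2 = 1 ∧ h i ⬝ᵥ w ≠ 0 ∧
    r = γ i * (hermForm (uplinkMatrix h G β lam i) w / hermForm (channelGram (h i)) w)}

/-- The update map `m = (m_i)_i`, where `m_i(lam)` is the least element of `updateValues`. -/
def updateMap {M KI : ℕ} (h : Fin KI → Fin M → ℂ) (γ : Fin KI → ℝ)
    (G : Matrix (Fin M) (Fin M) ℂ) (β : ℝ) (lam : Fin KI → ℝ) : Fin KI → ℝ :=
  fun i => sInf (updateValues h γ G β lam i)

/-- The fixed-point iteration `lam^(0) = lam0`, `lam^(n+1) = m(lam^(n))`. -/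
def fixedPointIter {M KI : ℕ} (h : Fin KI → Fin M → ℂ) (γ : Fin KI → ℝ)
    (G : Matrix (Fin M) (Fin M) ℂ) (β : ℝ) (lam0 : Fin KI → ℝ) : ℕ → Fin KI → ℝ
  | 0 => lam0
  | n + 1 => updateMap h γ G β (fixedPointIter h γ G β lam0 n)

end

/-! ### The Hermitian form -/

/-! Suppose the matrices stayed positive semidefinite at every iterate. Feasibility of the start
gives `m(lam0) ≤ lam0`, and `m` is monotone on iterates, so they decrease, remain nonnegative and
converge to some `mu`. The update inequality passes to the limit (`exists_dual_certificate`): `mu i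
* |h_i w|² ≤ γ i * w^H A_i(mu) w` for all `w`. Taking `w = w_i`, dividing by `γ i` and summing, the
SINR constraints absorb the cross terms, so the downlink objective is nonnegative
(`sum_hermForm_nonneg_of_dual_certificate`), contradicting `g(β) = -∞`. -/

theorem hermForm_smul {M : ℕ} (A : Matrix (Fin M) (Fin M) ℂ) (c : ℂ) (w : Fin M → ℂ) :
    hermForm A (c • w) = ‖c‖ ^ 2 * hermForm A w := by
  have hc : star c * c = ((‖c‖ ^ 2 : ℝ) : ℂ) := by
    push_cast
    exact Complex.conj_mul' c
  unfold hermForm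
  rw [Matrix.mulVec_smul, star_smul, smul_dotProduct, dotProduct_smul, smul_smul, hc,
    smul_eq_mul, Complex.re_ofReal_mul]

theorem hermForm_add {M : ℕ} (A B : Matrix (Fin M) (Fin M) ℂ) (w : Fin M → ℂ) :
    hermForm (A + B) w = hermForm A w + hermForm B w := by
  simp [hermForm, Matrix.add_mulVec, dotProduct_add]

theorem hermForm_ofReal_smul {M : ℕ} (c : ℝ) (A : Matrix (Fin M) (Fin M) ℂ) (w : Fin M → ℂ) :
    hermForm ((c : ℂ) • A) w = c * hermForm A w := by
  simp [hermForm, Matrix.smul_mulVec, dotProduct_smul]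

theorem hermForm_sum {M : ℕ} {ι : Type*} (s : Finset ι) (A : ι → Matrix (Fin M) (Fin M) ℂ)
    (w : Fin M → ℂ) : hermForm (∑ k ∈ s, A k) w = ∑ k ∈ s, hermForm (A k) w := by
  simp [hermForm, Matrix.sum_mulVec, dotProduct_sum]

theorem hermForm_channelGram {M : ℕ} (h w : Fin M → ℂ) :
    hermForm (channelGram h) w = ‖h ⬝ᵥ w‖ ^ 2 := by
  have hs : star w ⬝ᵥ star h = star (h ⬝ᵥ w) := by
    rw [← Matrix.star_dotProduct_star]
  have hc : star (h ⬝ᵥ w) * (h ⬝ᵥ w) = ((‖h ⬝ᵥ w‖ ^ 2 : ℝ) : ℂ) := by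
    push_cast
    exact Complex.conj_mul' _
  unfold hermForm channelGram
  rw [Matrix.vecMulVec_mulVec, dotProduct_smul, hs]
  simp only [MulOpposite.smul_eq_mul_unop, MulOpposite.unop_op]
  rw [hc, Complex.ofReal_re]

theorem hermForm_nonneg_of_posSemidef {M : ℕ} {A : Matrix (Fin M) (Fin M) ℂ} (hA : A.PosSemidef)
    (w : Fin M → ℂ) : 0 ≤ hermForm A w :=
  hA.re_dotProduct_nonneg w

theorem hermForm_conjTranspose_mul_self {M : ℕ} (B : Matrix (Fin M) (Fin M) ℂ) (w : Fin M → ℂ) :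
    hermForm (B.conjTranspose * B) w = ‖WithLp.toLp 2 (B.mulVec w)‖ ^ 2 := by
  rw [EuclideanSpace.norm_sq_eq]
  unfold hermForm
  rw [← Matrix.mulVec_mulVec, Matrix.dotProduct_mulVec, Matrix.vecMul_conjTranspose, star_star]
  simp only [dotProduct, Complex.re_sum]
  refine Finset.sum_congr rfl fun i _ => ?_
  have := Complex.conj_mul' (B.mulVec w i)
  simp only [Pi.star_apply, RCLike.star_def]
  rw [this, ← Complex.ofReal_pow, Complex.ofReal_re]

/-- A positive semidefinite Hermitian form attains its minimum on an affine hyperplane. -/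
theorem exists_isMinOn_hermForm_hyperplane {M : ℕ} {A : Matrix (Fin M) (Fin M) ℂ}
    (hA : A.PosSemidef) {h : Fin M → ℂ} (hh : ∃ w, h ⬝ᵥ w ≠ 0) :
    ∃ w₀, h ⬝ᵥ w₀ = 1 ∧ ∀ w, h ⬝ᵥ w = 1 → hermForm A w₀ ≤ hermForm A w := by
  obtain ⟨B, rfl⟩ : ∃ B : Matrix (Fin M) (Fin M) ℂ, A = B.conjTranspose * B := by
    open scoped MatrixOrder in
    exact CStarAlgebra.nonneg_iff_eq_star_mul_self.mp hA.nonneg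
  obtain ⟨v, hv⟩ := hh
  set u : Fin M → ℂ := (h ⬝ᵥ v)⁻¹ • v with hu
  have hu1 : h ⬝ᵥ u = 1 := by simp [hu, hv]
  let f : (Fin M → ℂ) →ₗ[ℂ] ℂ :=
    { toFun := fun w => h ⬝ᵥ w
      map_add' := fun x y => dotProduct_add h x y
      map_smul' := fun c x => dotProduct_smul c h x }
  let L : (Fin M → ℂ) →ₗ[ℂ] EuclideanSpace ℂ (Fin M) :=
    (WithLp.linearEquiv 2 ℂ (Fin M → ℂ)).symm.toLinearMap ∘ₗ B.mulVecLin
  have hL : ∀ w, hermForm (B.conjTranspose * B) w = ‖L w‖ ^ 2 := fun w =>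
    hermForm_conjTranspose_mul_self B w
  -- `B` may be singular, so the form need not be coercive. Instead, project `L u` onto the image of
  -- the hyperplane's direction space, which is complete by finite dimension.
  let K := (LinearMap.ker f).map L
  obtain ⟨_, ⟨x, hx, rfl⟩, hmin⟩ := K.exists_norm_eq_iInf_of_complete_subspace
    (completeSpace_coe_iff_isComplete.mp (FiniteDimensional.complete ℂ K)) (L u)
  have hx0 : h ⬝ᵥ x = 0 := hx
  refine ⟨u - x, by rw [dotProduct_sub, hu1, hx0, sub_zero], fun w hw => ?_⟩
  have hK : L (u - w) ∈ K := Submodule.mem_map_of_mem (by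
    change h ⬝ᵥ (u - w) = 0
    rw [dotProduct_sub, hu1, hw, sub_self])
  have hle : ‖L u - L x‖ ≤ ‖L u - L (u - w)‖ :=
    hmin.trans_le (ciInf_le (f := fun y : K => ‖L u - (y : EuclideanSpace ℂ (Fin M))‖)
      ⟨0, by rintro _ ⟨y, rfl⟩; exact norm_nonneg _⟩ ⟨L (u - w), hK⟩)
  rw [← map_sub, ← map_sub, sub_sub_cancel] at hle
  rw [hL, hL]
  gcongr

/-- The quotient is invariant under scaling, so the hyperplane minimizer can be normalized. -/
theorem exists_minimizer_hermForm_div {M : ℕ} {A : Matrix (Fin M) (Fin M) ℂ}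
    (hA : A.PosSemidef) {h : Fin M → ℂ} (hh : ∃ w, h ⬝ᵥ w ≠ 0) :
    ∃ w₀, ∑ a, ‖w₀ a‖ ^ 2 = 1 ∧ h ⬝ᵥ w₀ ≠ 0 ∧ ∀ w, h ⬝ᵥ w ≠ 0 →
      hermForm A w₀ / ‖h ⬝ᵥ w₀‖ ^ 2 ≤ hermForm A w / ‖h ⬝ᵥ w‖ ^ 2 := by
  obtain ⟨v, hv1, hv⟩ := exists_isMinOn_hermForm_hyperplane hA hh
  have hv0 : v ≠ 0 := by
    rintro rfl
    simp at hv1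
  set r : ℝ := ‖(WithLp.toLp 2 v : EuclideanSpace ℂ (Fin M))‖ with hr
  have hr0 : 0 < r := by
    rw [hr, norm_pos_iff]
    simpa using hv0
  have hr2 : ∑ a, ‖v a‖ ^ 2 = r ^ 2 := (EuclideanSpace.norm_sq_eq _).symm
  have hc : ((r⁻¹ : ℝ) : ℂ) ≠ 0 := by
    exact_mod_cast inv_ne_zero hr0.ne'
  have hcn : ‖((r⁻¹ : ℝ) : ℂ)‖ = r⁻¹ := by
    rw [Complex.norm_real, Real.norm_of_nonneg (inv_nonneg.mpr hr0.le)]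
  refine ⟨((r⁻¹ : ℝ) : ℂ) • v, ?_, ?_, fun w hw => ?_⟩
  · simp only [Pi.smul_apply, smul_eq_mul, norm_mul, mul_pow, hcn]
    rw [← Finset.mul_sum, hr2, ← mul_pow, inv_mul_cancel₀ hr0.ne', one_pow]
  · rw [dotProduct_smul, hv1, smul_eq_mul, mul_one]
    exact hc
  · have h1 := hv ((h ⬝ᵥ w)⁻¹ • w) (by rw [dotProduct_smul, smul_eq_mul, inv_mul_cancel₀ hw])
    rw [hermForm_smul, norm_inv, inv_pow] at h1
    have h2 : hermForm A (((r⁻¹ : ℝ) : ℂ) • v) / ‖h ⬝ᵥ (((r⁻¹ : ℝ) : ℂ) • v)‖ ^ 2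
        = hermForm A v := by
      rw [hermForm_smul, dotProduct_smul, hv1, smul_eq_mul, mul_one, hcn]
      field_simp
    rw [h2, div_eq_inv_mul]
    exact h1

/-! ### The update map -/

section Update

variable {M KI : ℕ} {h : Fin KI → Fin M → ℂ} {γ : Fin KI → ℝ}
  {G : Matrix (Fin M) (Fin M) ℂ} {β : ℝ} {lam mu : Fin KI → ℝ} {i : Fin KI}

theorem hermForm_uplinkMatrix (h : Fin KI → Fin M → ℂ) (G : Matrix (Fin M) (Fin M) ℂ) (β : ℝ)
    (lam : Fin KI → ℝ) (i : Fin KI) (w : Fin M → ℂ) :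
    hermForm (uplinkMatrix h G β lam i) w =
      ∑ k ∈ Finset.univ.erase i, lam k * ‖h k ⬝ᵥ w‖ ^ 2 + hermForm (noiseMatrix β G) w := by
  simp only [uplinkMatrix, hermForm_add, hermForm_sum, hermForm_ofReal_smul, hermForm_channelGram]

theorem hermForm_uplinkMatrix_mono (hle : lam ≤ mu) (w : Fin M → ℂ) :
    hermForm (uplinkMatrix h G β lam i) w ≤ hermForm (uplinkMatrix h G β mu i) w := by
  simp only [hermForm_uplinkMatrix]
  gcongr with k
  exact hle k

theorem isLeast_updateMap (hγ : 0 ≤ γ i) (hpos : (uplinkMatrix h G β lam i).PosSemidef)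
    (hh : ∃ w, h i ⬝ᵥ w ≠ 0) :
    IsLeast (updateValues h γ G β lam i) (updateMap h γ G β lam i) := by
  obtain ⟨v, hv1, hv0, hv⟩ := exists_minimizer_hermForm_div hpos hh
  have hleast : IsLeast (updateValues h γ G β lam i)
      (γ i * (hermForm (uplinkMatrix h G β lam i) v / hermForm (channelGram (h i)) v)) := by
    refine ⟨⟨v, hv1, hv0, rfl⟩, ?_⟩
    rintro _ ⟨w, -, hw, rfl⟩
    simp only [hermForm_channelGram]
    exact mul_le_mul_of_nonneg_left (hv w hw) hγ
  have : updateMap h γ G β lam i = _ := hleast.csInf_eq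
  rwa [this]

theorem updateMap_nonneg (hγ : 0 ≤ γ i) (hpos : (uplinkMatrix h G β lam i).PosSemidef) :
    0 ≤ updateMap h γ G β lam i := by
  -- This also covers `h i = 0`: the value set is then empty and its `sInf` is `0`.
  refine Real.sInf_nonneg ?_
  rintro _ ⟨w, -, -, rfl⟩
  exact mul_nonneg hγ (div_nonneg (hermForm_nonneg_of_posSemidef hpos w)
    (by rw [hermForm_channelGram]; positivity))

/-- Without the quotient, the bound also holds where `h i ⬝ᵥ w = 0` and is stable under limits in
`lam`. -/
theorem updateMap_mul_le (hγ : 0 ≤ γ i) (hpos : (uplinkMatrix h G β lam i).PosSemidef)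
    (w : Fin M → ℂ) :
    updateMap h γ G β lam i * ‖h i ⬝ᵥ w‖ ^ 2 ≤ γ i * hermForm (uplinkMatrix h G β lam i) w := by
  by_cases hw : h i ⬝ᵥ w = 0
  · rw [hw, norm_zero, zero_pow two_ne_zero, mul_zero]
    exact mul_nonneg hγ (hermForm_nonneg_of_posSemidef hpos w)
  obtain ⟨v, hv1, hv0, hv⟩ := exists_minimizer_hermForm_div hpos ⟨w, hw⟩
  have hle := (isLeast_updateMap hγ hpos ⟨w, hw⟩).2 ⟨v, hv1, hv0, rfl⟩
  rw [hermForm_channelGram] at hle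
  have := hle.trans (mul_le_mul_of_nonneg_left (hv w hw) hγ)
  rwa [← mul_div_assoc, le_div_iff₀ (by positivity)] at this

theorem updateMap_mono (hγ : 0 ≤ γ i) (hle : lam ≤ mu)
    (hlam : (uplinkMatrix h G β lam i).PosSemidef) (hmu : (uplinkMatrix h G β mu i).PosSemidef)
    (hh : ∃ w, h i ⬝ᵥ w ≠ 0) : updateMap h γ G β lam i ≤ updateMap h γ G β mu i := by
  -- The minimizer for `mu` serves as a test vector for `lam`.
  obtain ⟨w, -, hw, hval⟩ := (isLeast_updateMap hγ hmu hh).1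
  rw [hval, ← mul_div_assoc, hermForm_channelGram, le_div_iff₀ (by positivity)]
  exact (updateMap_mul_le hγ hlam w).trans
    (mul_le_mul_of_nonneg_left (hermForm_uplinkMatrix_mono hle w) hγ)

theorem UplinkFeasible.exists_mul_hermForm_le (hlam : UplinkFeasible h γ G β lam)
    (hγ : ∀ i, 0 < γ i) (i : Fin KI) :
    ∃ w, h i ⬝ᵥ w ≠ 0 ∧ γ i * hermForm (uplinkMatrix h G β lam i) w ≤ lam i * ‖h i ⬝ᵥ w‖ ^ 2 := by
  obtain ⟨hnn, w, hw⟩ := hlam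
  have hi := hw i
  rw [uplinkSINR, hermForm_channelGram] at hi
  have hnum : 0 ≤ lam i * ‖h i ⬝ᵥ w i‖ ^ 2 := mul_nonneg (hnn i) (by positivity)
  have hden : 0 < hermForm (uplinkMatrix h G β lam i) (w i) := by
    by_contra! hneg
    exact ((hγ i).trans_le hi).not_ge (div_nonpos_of_nonneg_of_nonpos hnum hneg)
  refine ⟨w i, fun h0 => ?_, (le_div_iff₀ hden).mp hi⟩
  rw [h0] at hi
  simp only [norm_zero, ne_eq, OfNat.ofNat_ne_zero, not_false_eq_true, zero_pow, mul_zero,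
    zero_div] at hi
  exact (hγ i).not_ge hi

theorem UplinkFeasible.updateMap_le (hlam : UplinkFeasible h γ G β lam) (hγ : ∀ i, 0 < γ i)
    (hpos : (uplinkMatrix h G β lam i).PosSemidef) : updateMap h γ G β lam i ≤ lam i := by
  obtain ⟨w, hw, hle⟩ := hlam.exists_mul_hermForm_le hγ i
  exact le_of_mul_le_mul_right ((updateMap_mul_le (hγ i).le hpos w).trans hle) (by positivity)

/-- A fixed-point iteration that never leaves the region where the interference-plus-noise
matrices are positive semidefinite converges to a dual certificate. -/
theorem exists_dual_certificate (hγ : ∀ i, 0 < γ i) (hlam : UplinkFeasible h γ G β lam)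
    (hpos : ∀ n i, (uplinkMatrix h G β (fixedPointIter h γ G β lam n) i).PosSemidef) :
    ∃ mu : Fin KI → ℝ, (∀ i, 0 ≤ mu i) ∧ ∀ i w,
      mu i * ‖h i ⬝ᵥ w‖ ^ 2 ≤ γ i * hermForm (uplinkMatrix h G β mu i) w := by
  set x := fixedPointIter h γ G β lam with hx
  have hsucc : ∀ n, x (n + 1) = updateMap h γ G β (x n) := fun n => rfl
  have hh : ∀ i, ∃ w, h i ⬝ᵥ w ≠ 0 := fun i =>
    (hlam.exists_mul_hermForm_le hγ i).imp fun _ hw => hw.1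
  have hnn : ∀ n i, 0 ≤ x n i
    | 0, i => hlam.1 i
    | n + 1, i => updateMap_nonneg (hγ i).le (hpos n i)
  have hstep : ∀ n, x (n + 1) ≤ x n := by
    intro n
    induction n with
    | zero => exact fun i => hlam.updateMap_le hγ (hpos 0 i)
    | succ n ih => exact fun i => updateMap_mono (hγ i).le ih (hpos (n + 1) i) (hpos n i) (hh i)
  have hlim : ∀ i, Filter.Tendsto (fun n => x n i) Filter.atTop (nhds (⨅ n, x n i)) := fun i =>
    tendsto_atTop_ciInf (antitone_nat_of_succ_le fun n => hstep n i)
      ⟨0, by rintro _ ⟨n, rfl⟩; exact hnn n i⟩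
  refine ⟨fun i => ⨅ n, x n i, fun i => le_ciInf fun n => hnn n i, fun i w => ?_⟩
  have hform : Filter.Tendsto (fun n => hermForm (uplinkMatrix h G β (x n) i) w) Filter.atTop
      (nhds (hermForm (uplinkMatrix h G β (fun i => ⨅ n, x n i) i) w)) := by
    simp only [hermForm_uplinkMatrix]
    exact (tendsto_finsetSum _ fun k _ => (hlim k).mul_const _).add_const _
  -- The left side involves the iterate `n + 1`, the right side the iterate `n`; both have the same
  -- limit.
  exact le_of_tendsto_of_tendsto' (((hlim i).comp (Filter.tendsto_add_atTop_nat 1)).mul_const _)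
    (hform.const_mul _) fun n => updateMap_mul_le (hγ i).le (hpos n i) w

/-- Weak duality between the downlink problem and the dual uplink problem. -/
theorem sum_hermForm_nonneg_of_dual_certificate {σ : Fin KI → ℝ} (hσ : ∀ i, 0 < σ i)
    (hγ : ∀ i, 0 < γ i) (hmu : ∀ i, 0 ≤ mu i)
    (hcert : ∀ i w, mu i * ‖h i ⬝ᵥ w‖ ^ 2 ≤ γ i * hermForm (uplinkMatrix h G β mu i) w)
    {w : Fin KI → Fin M → ℂ} (hw : ∀ i, γ i ≤ downlinkSINR h σ w i) :
    0 ≤ ∑ i, hermForm (noiseMatrix β G) (w i) := by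
  have hswap : ∑ i, ∑ k ∈ Finset.univ.erase i, mu k * ‖h k ⬝ᵥ w i‖ ^ 2 =
      ∑ k, mu k * ∑ i ∈ Finset.univ.erase k, ‖h k ⬝ᵥ w i‖ ^ 2 := by
    simp only [Finset.mul_sum]
    refine Finset.sum_comm' fun i k => ?_
    simp [ne_comm]
  have hlow : ∀ i, mu i * (‖h i ⬝ᵥ w i‖ ^ 2 / γ i) ≤
      ∑ k ∈ Finset.univ.erase i, mu k * ‖h k ⬝ᵥ w i‖ ^ 2 + hermForm (noiseMatrix β G) (w i) := by
    intro i
    rw [← hermForm_uplinkMatrix, ← mul_div_assoc, div_le_iff₀' (hγ i)]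
    exact hcert i (w i)
  have hsinr : ∀ i, mu i * ∑ k ∈ Finset.univ.erase i, ‖h i ⬝ᵥ w k‖ ^ 2 ≤
      mu i * (‖h i ⬝ᵥ w i‖ ^ 2 / γ i) := by
    intro i
    refine mul_le_mul_of_nonneg_left ?_ (hmu i)
    have hσi := pow_pos (hσ i) 2
    have hden : 0 < ∑ k ∈ Finset.univ.erase i, ‖h i ⬝ᵥ w k‖ ^ 2 + σ i ^ 2 := by positivity
    have := (le_div_iff₀ hden).mp (hw i)
    rw [le_div_iff₀' (hγ i)]
    -- The noise term `γ i * σ i ^ 2` is positive and is dropped.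
    nlinarith [hγ i]
  have h1 := Finset.sum_le_sum fun i (_ : i ∈ Finset.univ) => hlow i
  have h2 := Finset.sum_le_sum fun i (_ : i ∈ Finset.univ) => hsinr i
  rw [Finset.sum_add_distrib, hswap] at h1
  linarith

end Update

/-- If `β I - G` is not positive semidefinite and `g(β) = -∞`, then the fixed-point iteration, from
any feasible point of the dual uplink problem, reaches after finitely many steps a point `lam^(n)`
at which `∑_{k ≠ i} lam_k^(n) h_k^H h_k + β I - G` is not positive semidefinite for some `i`. All
the earlier steps are genuine: the minima that define the updates exist and are attained. -/
theorem proposition4p5 {M KI KE : ℕ}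
    (h : Fin KI → Fin M → ℂ) (g : Fin KE → Fin M → ℂ)
    (ζ : ℝ) (hζ0 : 0 < ζ) (hζ1 : ζ ≤ 1)
    (α : Fin KE → ℝ) (hα : ∀ j, 0 ≤ α j)
    (σ : Fin KI → ℝ) (hσ : ∀ i, 0 < σ i)
    (γ : Fin KI → ℝ) (hγ : ∀ i, 0 < γ i)
    (G : Matrix (Fin M) (Fin M) ℂ) (hG : G = energyMatrix ζ α g)
    (β : ℝ) (hβ : 0 ≤ β)
    (hnot : ¬ (noiseMatrix β G).PosSemidef)
    (hunb : downlinkValue h σ γ G β = ⊥)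
    (lam0 : Fin KI → ℝ) (hlam0 : UplinkFeasible h γ G β lam0) :
    ∃ n : ℕ,
      (∀ m < n, ∀ i : Fin KI,
        (uplinkMatrix h G β (fixedPointIter h γ G β lam0 m) i).PosSemidef ∧
        IsLeast (updateValues h γ G β (fixedPointIter h γ G β lam0 m) i)
          (fixedPointIter h γ G β lam0 (m + 1) i)) ∧
      ∃ i : Fin KI, ¬ (uplinkMatrix h G β (fixedPointIter h γ G β lam0 n) i).PosSemidef := by
  classical
  have hex : ∃ n, ∃ i, ¬ (uplinkMatrix h G β (fixedPointIter h γ G β lam0 n) i).PosSemidef := by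
    by_contra! hpos
    obtain ⟨mu, hmu, hcert⟩ := exists_dual_certificate hγ hlam0 hpos
    have hge : (0 : EReal) ≤ downlinkValue h σ γ G β := le_iInf₂ fun w hw => by
      exact_mod_cast sum_hermForm_nonneg_of_dual_certificate hσ hγ hmu hcert hw
    rw [hunb] at hge
    exact absurd hge (by simp)
  -- Taking the first failure makes every earlier matrix positive semidefinite, so those minima are
  -- attained.
  refine ⟨Nat.find hex, fun m hm i => ?_, Nat.find_spec hex⟩
  have hpos : (uplinkMatrix h G β (fixedPointIter h γ G β lam0 m) i).PosSemidef := by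
    by_contra hneg
    exact Nat.find_min hex hm ⟨i, hneg⟩
  exact ⟨hpos, isLeast_updateMap (hγ i).le hpos
    ((hlam0.exists_mul_hermForm_le hγ i).imp fun _ hw => hw.1)⟩
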